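/- Let $\mathcal P_d$ be the space of complex polynomials $f=\sum_{i=0}^d f_i x^i$ of degree at most $d$, with Weyl's unitarily invariant norm $\|f\|_d=\bigl(\sum_{i=0}^d |f_i|^2/\binom di\bigr)^{1/2}$, and let $\mathbb P\mathcal P_d$ be its projectivization, with the normalized volume measure $\mu$ (total mass one) induced by this norm. Denote by $\zeta_1,\zeta_2,\dots$ the roots of $f$ in $\mathbb C$. For every $d$ there is a constant $M>0$, depending only on $d$, such that for every $\epsilon>0$ the following holds. (a) If $f$ is uniformly distributed on $\mathbb P\mathcal P_d$ (that is, with law $\mu$), or if $f\in\mathcal P_d$ is normally distributed with density proportional to $e^{-\|f\|_d^2}$, then the event $$\min_{|\zeta_i|>|\zeta_j|}\frac{|\zeta_i|}{|\zeta_j|}>1+\epsilon$$ is measurable and has probability larger than $1-M\epsilon$. (The minimum is over all pairs of roots with $|\zeta_i|>|\zeta_j|$; the quotient is $+\infty$ if $\zeta_j=0$, and the minimum is $+\infty$ if there is no such pair.) (b) If $f$ is distributed on $\mathbb P\mathcal P_d$ according to any probability measure that is absolutely continuous with respect to $\mu$ with Radon–Nikodym derivative bounded by $K$ almost everywhere,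 then this event has probability larger than $1-KM\epsilon$, with the same $M$. -/

import Mathlib

open MeasureTheory Metric Polynomial
open scoped ENNReal NNReal LinearAlgebra.Projectivization

noncomputable section

/-- The space `𝒫_d` of complex polynomials of degree at most `d`. -/
def PolyDeg (d : ℕ) : Type := Polynomial.degreeLE ℂ (d : WithBot ℕ)

namespace PolyDeg

instance (d : ℕ) : AddCommGroup (PolyDeg d) :=
  inferInstanceAs (AddCommGroup (Polynomial.degreeLE ℂ (d : WithBot ℕ)))

instance (d : ℕ) : Module ℂ (PolyDeg d) :=
  inferInstanceAs (Module ℂ (Polynomial.degreeLE ℂ (d : WithBot ℕ)))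

/-- The inclusion of `𝒫_d` into `ℂ[X]`. -/
def toPoly (d : ℕ) : PolyDeg d →ₗ[ℂ] ℂ[X] :=
  Submodule.subtype (Polynomial.degreeLE ℂ (d : WithBot ℕ))

/-- The coordinates of `f = ∑ f_i X^i` in the basis of the monomials rescaled to length one for the
Weyl norm: `i ↦ f_i / √(d choose i)`. -/
def weylCoord (d : ℕ) : PolyDeg d →ₗ[ℂ] EuclideanSpace ℂ (Fin (d + 1)) where
  toFun f := WithLp.toLp 2 fun i => (toPoly d f).coeff i / (Real.sqrt (d.choose i) : ℂ)
  map_add' f g := by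
    ext i
    simp [add_div]
  map_smul' c f := by
    ext i
    simp [mul_div_assoc]

theorem weylCoord_injective (d : ℕ) : Function.Injective (weylCoord d) := by
  rw [← LinearMap.ker_eq_bot, LinearMap.ker_eq_bot']
  intro f hf
  apply Subtype.ext
  change toPoly d f = 0
  ext n
  rcases Nat.lt_or_ge d n with hn | hn
  · rw [coeff_zero]
    apply coeff_eq_zero_of_degree_lt
    exact lt_of_le_of_lt (mem_degreeLE.1 f.2) (by exact_mod_cast hn)
  · have h := congrArg (fun v : EuclideanSpace ℂ (Fin (d + 1)) => v ⟨n, by omega⟩) hf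
    have hc : (0 : ℝ) < d.choose n := by exact_mod_cast Nat.choose_pos hn
    have hs : ((Real.sqrt (d.choose n) : ℝ) : ℂ) ≠ 0 := by
      exact_mod_cast (Real.sqrt_pos.2 hc).ne'
    simpa [weylCoord, hs] using h

/-- Weyl's unitarily invariant norm on `𝒫_d`; see `norm_eq` for the formula. -/
instance (d : ℕ) : NormedAddCommGroup (PolyDeg d) :=
  NormedAddCommGroup.induced (PolyDeg d) (EuclideanSpace ℂ (Fin (d + 1))) (weylCoord d)
    (weylCoord_injective d)

instance (d : ℕ) : NormedSpace ℂ (PolyDeg d) :=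
  NormedSpace.induced ℂ (PolyDeg d) (EuclideanSpace ℂ (Fin (d + 1))) (weylCoord d)

/-- The Weyl norm of `f = ∑ f_i X^i` is `√(∑ |f_i|² / (d choose i))`. -/
theorem norm_eq (d : ℕ) (f : PolyDeg d) :
    ‖f‖ = Real.sqrt (∑ i ∈ Finset.range (d + 1), ‖(toPoly d f).coeff i‖ ^ 2 / d.choose i) := by
  change ‖weylCoord d f‖ = _
  rw [EuclideanSpace.norm_eq, Finset.sum_range]
  simp [weylCoord, div_pow]

instance (d : ℕ) : FiniteDimensional ℂ (PolyDeg d) :=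
  FiniteDimensional.of_injective (weylCoord d) (weylCoord_injective d)

instance (d : ℕ) : ProperSpace (PolyDeg d) := FiniteDimensional.proper ℂ (PolyDeg d)

instance (d : ℕ) : MeasurableSpace (PolyDeg d) := borel (PolyDeg d)

instance (d : ℕ) : BorelSpace (PolyDeg d) := ⟨rfl⟩

/-- The quotient topology on the projective space `ℙ𝒫_d`. -/
instance (d : ℕ) : TopologicalSpace (ℙ ℂ (PolyDeg d)) :=
  inferInstanceAs (TopologicalSpace (Quotient (projectivizationSetoid ℂ (PolyDeg d))))

/-- The Borel σ-algebra on the projective space `ℙ𝒫_d`. -/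
instance (d : ℕ) : MeasurableSpace (ℙ ℂ (PolyDeg d)) := borel (ℙ ℂ (PolyDeg d))

instance (d : ℕ) : BorelSpace (ℙ ℂ (PolyDeg d)) := ⟨rfl⟩

/-- The map from the unit sphere of the Weyl norm to `ℙ𝒫_d`. -/
def sphereToProj (d : ℕ) (f : sphere (0 : PolyDeg d) 1) : ℙ ℂ (PolyDeg d) :=
  Projectivization.mk ℂ (f : PolyDeg d) (ne_zero_of_mem_unit_sphere f)

/-- The (normalised) surface measure of the unit sphere of the Weyl norm. -/
def sphereProb (d : ℕ) : Measure (sphere (0 : PolyDeg d) 1) :=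
  ((Measure.addHaar : Measure (PolyDeg d)).toSphere Set.univ)⁻¹ •
    (Measure.addHaar : Measure (PolyDeg d)).toSphere

/-- The uniform probability on `ℙ𝒫_d`: the volume of the Riemannian (Fubini–Study) structure
induced by the Weyl norm, normalised to total mass one. As `sphereToProj` is a Riemannian
submersion with isometric fibres, it is the image of the uniform probability on the sphere. -/
def uniformProj (d : ℕ) : Measure (ℙ ℂ (PolyDeg d)) := (sphereProb d).map (sphereToProj d)

/-- The unnormalised Gaussian measure on `𝒫_d`, with density `exp (-‖f‖²)`. -/
def gaussianUnnorm (d : ℕ) : Measure (PolyDeg d) :=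
  (Measure.addHaar : Measure (PolyDeg d)).withDensity fun f => ENNReal.ofReal (Real.exp (-‖f‖ ^ 2))

/-- The unitarily invariant normal distribution on `𝒫_d`: its density is proportional to
`exp (-‖f‖²)`, that is, the coefficients `f_i` are independent centred complex Gaussian variables
with `𝔼 |f_i|² = (d choose i)`. -/
def gaussianProb (d : ℕ) : Measure (PolyDeg d) :=
  (gaussianUnnorm d Set.univ)⁻¹ • gaussianUnnorm d

end PolyDeg

/-- The minimum of `|ζ| / |ξ|` over all pairs of roots `ζ`, `ξ` of `p` with `|ζ| > |ξ|`, as an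
extended nonnegative real: the quotient is `∞` if `ξ = 0`, and the minimum over the empty set is
`∞`. -/
def minRootRatio (p : ℂ[X]) : ℝ≥0∞ :=
  ⨅ (ζ ∈ p.roots) (ξ ∈ p.roots) (_ : ‖ξ‖ < ‖ζ‖), ‖ζ‖ₑ / ‖ξ‖ₑ

/-- The minimal ratio of roots as a function on `ℙ𝒫_d`. -/
def minRootRatioProj (d : ℕ) (x : ℙ ℂ (PolyDeg d)) : ℝ≥0∞ :=
  Projectivization.lift (fun f => minRootRatio (PolyDeg.toPoly d f))
    (by
      intro f g t h
      have ht : t ≠ 0 := by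
        rintro rfl
        exact f.2 (by rw [h, zero_smul])
      simp only [h, map_smul, minRootRatio, roots_smul_nonzero _ ht])
    x

end

/-! The bad event, two roots with `|ξ| < |ζ| ≤ (1 + ε)|ξ|`, is a complex cone. So the projective and
Gaussian laws both give it the uniform probability of its trace on the sphere, which is at most its
Haar measure in the unit ball divided by that of the ball (`gaussianProb_of_cone`,
`sphereProb_le_of_cone`). It remains to show that this Haar measure is `O(ε)`.

Take first `|ξ| ≤ 1`. Two distinct roots and the coefficients of degree at least two determine the
two lowest coefficients through a polynomial map. The bad polynomials therefore lie in the image of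
a bounded set in which `ζ` ranges over an annulus of area `O(ε)`. The Jacobian is bounded there, so
the image has volume `O(ε)` (`exists_volume_image_closePairs_le`). If `|ξ| > 1`, reversing the
coefficients inverts the roots and leads back to the first case (`hasCloseRoots_inter_ball_subset`).
A law with density at most `K` loses only a factor `K`. -/

noncomputable section

/-! ### The bad event in terms of pairs of roots -/

/-- `p` is nonzero and has roots `ζ`, `ξ` with `|ξ| < |ζ| ≤ (1 + ε) |ξ|`. -/
def HasCloseRoots (ε : ℝ) (p : ℂ[X]) : Prop :=
  p ≠ 0 ∧ ∃ ζ ξ : ℂ, p.IsRoot ζ ∧ p.IsRoot ξ ∧ ‖ξ‖ < ‖ζ‖ ∧ ‖ζ‖ ≤ (1 + ε) * ‖ξ‖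

/-- A strict lower bound passes to a finite infimum, though not to an arbitrary one. -/
theorem minRootRatio_eq_inf (p : ℂ[X]) :
    minRootRatio p = ((p.roots.toFinset ×ˢ p.roots.toFinset).filter
      fun x : ℂ × ℂ => ‖x.2‖ < ‖x.1‖).inf fun x => ‖x.1‖ₑ / ‖x.2‖ₑ := by
  refine le_antisymm ?_ ?_
  · refine Finset.le_inf fun x hx => ?_
    simp only [Finset.mem_filter, Finset.mem_product, Multiset.mem_toFinset] at hx
    exact iInf₂_le_of_le x.1 hx.1.1 (iInf₂_le_of_le x.2 hx.1.2 (iInf_le _ hx.2))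
  · refine le_iInf₂ fun ζ hζ => le_iInf₂ fun ξ hξ => le_iInf fun h => ?_
    exact Finset.inf_le (f := fun x : ℂ × ℂ => ‖x.1‖ₑ / ‖x.2‖ₑ) (b := (ζ, ξ))
      (by simpa [h] using And.intro (by simpa using hζ) (by simpa using hξ))

theorem enorm_div_le_ofReal_iff {ζ ξ : ℂ} (h : ‖ξ‖ < ‖ζ‖) {c : ℝ} (hc : 0 ≤ c) :
    ‖ζ‖ₑ / ‖ξ‖ₑ ≤ ENNReal.ofReal c ↔ ‖ζ‖ ≤ c * ‖ξ‖ := by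
  have hζ : ‖ζ‖ₑ ≠ 0 := by
    have := (norm_nonneg ξ).trans_lt h
    simpa using this
  rw [ENNReal.div_le_iff_le_mul (Or.inr ENNReal.ofReal_ne_top) (Or.inl (by simp)),
    ← ofReal_norm, ← ofReal_norm, ← ENNReal.ofReal_mul hc, ENNReal.ofReal_le_ofReal_iff]
  exact mul_nonneg hc (norm_nonneg ξ)

theorem lt_minRootRatio_iff {ε : ℝ} (hε : 0 ≤ ε) (p : ℂ[X]) :
    ENNReal.ofReal (1 + ε) < minRootRatio p ↔ ¬ HasCloseRoots ε p := by
  rw [minRootRatio_eq_inf, Finset.lt_inf_iff (by simp)]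
  simp only [Finset.mem_filter, Finset.mem_product, Multiset.mem_toFinset, Prod.forall,
    HasCloseRoots, not_and, not_exists, mem_roots', ne_eq]
  constructor
  · intro h hp ζ ξ hζ hξ hlt hle
    exact (h ζ ξ ⟨⟨⟨hp, hζ⟩, hp, hξ⟩, hlt⟩).not_ge
      ((enorm_div_le_ofReal_iff hlt (by linarith)).2 hle)
  · rintro h ζ ξ ⟨⟨⟨hp, hζ⟩, -, hξ⟩, hlt⟩
    refine lt_of_not_ge fun hle => h hp ζ ξ hζ hξ hlt ?_
    exact (enorm_div_le_ofReal_iff hlt (by linarith)).1 hle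

theorem hasCloseRoots_smul_iff {ε : ℝ} {t : ℂ} (ht : t ≠ 0) (p : ℂ[X]) :
    HasCloseRoots ε (t • p) ↔ HasCloseRoots ε p := by
  simp [HasCloseRoots, IsRoot.def, ht]

theorem HasCloseRoots.two_le_natDegree {ε : ℝ} {p : ℂ[X]} (h : HasCloseRoots ε p) :
    2 ≤ p.natDegree := by
  obtain ⟨hp, ζ, ξ, hζ, hξ, hlt, -⟩ := h
  have hne : ζ ≠ ξ := by
    rintro rfl
    exact lt_irrefl _ hlt
  rw [← Finset.card_pair hne]
  refine (Finset.card_le_card ?_).trans ((Multiset.toFinset_card_le _).trans (card_roots' p))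
  intro z hz
  rcases Finset.mem_insert.1 hz with rfl | hz
  · simpa [hp] using hζ
  · rw [Finset.mem_singleton.1 hz]
    simpa [hp] using hξ

/-! ### Measurability of the bad event -/

namespace PolyDeg

variable {d : ℕ}

theorem natDegree_toPoly_le (f : PolyDeg d) : (toPoly d f).natDegree ≤ d :=
  natDegree_le_of_degree_le (mem_degreeLE.1 f.2)

theorem toPoly_injective (d : ℕ) : Function.Injective (toPoly d) := Subtype.val_injective

theorem toPoly_ne_zero_iff {f : PolyDeg d} : toPoly d f ≠ 0 ↔ f ≠ 0 :=
  (map_ne_zero_iff _ (toPoly_injective d))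

theorem continuous_coeff (i : ℕ) : Continuous fun f : PolyDeg d => (toPoly d f).coeff i :=
  LinearMap.continuous_of_finiteDimensional ((lcoeff ℂ i).comp (toPoly d))

theorem eval_toPoly (f : PolyDeg d) (z : ℂ) :
    (toPoly d f).eval z = ∑ i ∈ Finset.range (d + 1), (toPoly d f).coeff i * z ^ i :=
  eval_eq_sum_range' (Nat.lt_succ_of_le (natDegree_toPoly_le f)) z

theorem continuous_eval :
    Continuous fun x : PolyDeg d × ℂ => (toPoly d x.1).eval x.2 := by
  simp only [eval_toPoly]
  exact continuous_finsetSum _ fun i _ =>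
    ((continuous_coeff i).comp continuous_fst).mul (continuous_snd.pow i)

/-- The pairs `(ζ, ξ)` with `(1 + 1/(n+1)) |ξ| ≤ |ζ| ≤ (1 + ε) |ξ|`, bounded and bounded away
from the origin. -/
def compactPairs (ε : ℝ) (n : ℕ) : Set (ℂ × ℂ) :=
  {x | (1 + 1 / ((n : ℝ) + 1)) * ‖x.2‖ ≤ ‖x.1‖ ∧ ‖x.1‖ ≤ (1 + ε) * ‖x.2‖ ∧
    1 / ((n : ℝ) + 1) ≤ ‖x.2‖ ∧ ‖x.2‖ ≤ n ∧ ‖x.1‖ ≤ n}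

theorem isCompact_compactPairs (ε : ℝ) (n : ℕ) : IsCompact (compactPairs ε n) := by
  refine Metric.isCompact_of_isClosed_isBounded ?_ ?_
  · simp only [compactPairs, Set.ofPred_and]
    refine IsClosed.inter (isClosed_le (by fun_prop) (by fun_prop)) (IsClosed.inter
      (isClosed_le (by fun_prop) (by fun_prop)) (IsClosed.inter
      (isClosed_le (by fun_prop) (by fun_prop)) (IsClosed.inter
      (isClosed_le (by fun_prop) (by fun_prop)) (isClosed_le (by fun_prop) (by fun_prop)))))
  · refine (isBounded_closedBall (x := (0 : ℂ × ℂ)) (r := n)).subset fun x hx => ?_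
    rw [mem_closedBall_zero_iff, Prod.norm_def]
    exact max_le hx.2.2.2.2 hx.2.2.2.1

/-- The polynomials in `𝒫_d` that vanish at both entries of a pair in `compactPairs`. -/
def rootLevel (d : ℕ) (ε : ℝ) (n : ℕ) : Set (PolyDeg d) :=
  {f | ∃ x ∈ compactPairs ε n, (toPoly d f).IsRoot x.1 ∧ (toPoly d f).IsRoot x.2}

/-- Projection along a compact factor is a closed map. -/
theorem isClosed_rootLevel (ε : ℝ) (n : ℕ) : IsClosed (rootLevel d ε n) := by
  have : CompactSpace (compactPairs ε n) := isCompact_iff_compactSpace.1 (isCompact_compactPairs ε n)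
  have hC : IsClosed {y : compactPairs ε n × PolyDeg d |
      (toPoly d y.2).eval y.1.1.1 = 0 ∧ (toPoly d y.2).eval y.1.1.2 = 0} := by
    rw [Set.ofPred_and]
    refine IsClosed.inter (isClosed_eq ?_ continuous_const) (isClosed_eq ?_ continuous_const)
    · exact continuous_eval.comp (f := fun y : compactPairs ε n × PolyDeg d => (y.2, y.1.1.1))
        (by fun_prop)
    · exact continuous_eval.comp (f := fun y : compactPairs ε n × PolyDeg d => (y.2, y.1.1.2))
        (by fun_prop)
  convert isClosedMap_snd_of_compactSpace _ hC
  ext f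
  constructor
  · rintro ⟨x, hx, h⟩
    exact ⟨(⟨x, hx⟩, f), h, rfl⟩
  · rintro ⟨⟨⟨x, hx⟩, f⟩, h, rfl⟩
    exact ⟨x, hx, h⟩

/-- The strict inequality is not a closed condition; the margin `1/(n+1)` exhausts it by countably
many closed ones. -/
theorem hasCloseRoots_iff_exists_rootLevel (ε : ℝ) (f : PolyDeg d) :
    HasCloseRoots ε (toPoly d f) ↔ f ≠ 0 ∧ ∃ n, f ∈ rootLevel d ε n := by
  rw [HasCloseRoots, toPoly_ne_zero_iff]
  refine and_congr_right fun _ => ⟨?_, ?_⟩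
  · rintro ⟨ζ, ξ, hζ, hξ, hlt, hle⟩
    -- If `ξ = 0`, the upper bound would force `ζ = 0` as well.
    have hξ0 : 0 < ‖ξ‖ := by
      rcases (norm_nonneg ξ).eq_or_lt with h | h
      · rw [← h] at hlt hle
        linarith
      · exact h
    obtain ⟨a, ha⟩ := exists_nat_one_div_lt (K := ℝ) (sub_pos.2 ((one_lt_div hξ0).2 hlt))
    obtain ⟨b, hb⟩ := exists_nat_one_div_lt hξ0
    obtain ⟨c, hc⟩ := exists_nat_ge ‖ζ‖
    have key : ∀ k, k ≤ max a (max b c) →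
        1 / (((max a (max b c) : ℕ) : ℝ) + 1) ≤ 1 / ((k : ℝ) + 1) := by
      intro k hk
      have : (k : ℝ) ≤ ((max a (max b c) : ℕ) : ℝ) := by exact_mod_cast hk
      gcongr
    refine ⟨max a (max b c), (ζ, ξ), ⟨?_, hle, ?_, ?_, ?_⟩, hζ, hξ⟩
    · rw [← le_div_iff₀ hξ0]
      have := key a (by simp)
      linarith
    · exact (key b (by simp)).trans hb.le
    · exact hlt.le.trans (hc.trans (by exact_mod_cast (by simp : c ≤ max a (max b c))))
    · exact hc.trans (by exact_mod_cast (by simp : c ≤ max a (max b c)))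
  · rintro ⟨n, ⟨ζ, ξ⟩, ⟨h1, h2, h3, -, -⟩, hζ, hξ⟩
    refine ⟨ζ, ξ, hζ, hξ, ?_, h2⟩
    have hn : 0 < 1 / ((n : ℝ) + 1) := by positivity
    have : 0 < ‖ξ‖ := hn.trans_le h3
    have h1' : (1 + 1 / ((n : ℝ) + 1)) * ‖ξ‖ ≤ ‖ζ‖ := h1
    nlinarith

theorem measurableSet_hasCloseRoots (d : ℕ) (ε : ℝ) :
    MeasurableSet {f : PolyDeg d | HasCloseRoots ε (toPoly d f)} := by
  have : {f : PolyDeg d | HasCloseRoots ε (toPoly d f)} = {0}ᶜ ∩ ⋃ n, rootLevel d ε n := by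
    ext f
    simp [hasCloseRoots_iff_exists_rootLevel]
  rw [this]
  exact (measurableSet_singleton _).compl.inter
    (MeasurableSet.iUnion fun n => (isClosed_rootLevel ε n).measurableSet)

theorem rootLevel_smul_iff {ε : ℝ} {n : ℕ} {t : ℂ} (ht : t ≠ 0) (f : PolyDeg d) :
    t • f ∈ rootLevel d ε n ↔ f ∈ rootLevel d ε n := by
  simp [rootLevel, IsRoot.def, ht]

theorem exists_smul_rep (v : PolyDeg d) (hv : v ≠ 0) :
    ∃ t : ℂ, t ≠ 0 ∧ (Projectivization.mk ℂ v hv).rep = t • v := by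
  obtain ⟨a, ha⟩ := Projectivization.exists_smul_eq_mk_rep ℂ v hv
  exact ⟨a, a.ne_zero, ha.symm⟩

theorem isQuotientMap_mk' (d : ℕ) :
    Topology.IsQuotientMap (Projectivization.mk' ℂ : {v : PolyDeg d // v ≠ 0} → ℙ ℂ (PolyDeg d)) :=
  isQuotientMap_quotient_mk'

theorem minRootRatioProj_eq (x : ℙ ℂ (PolyDeg d)) :
    minRootRatioProj d x = minRootRatio (toPoly d x.rep) := by
  conv_lhs => rw [← x.mk_rep]
  rfl

/-- Closedness in the quotient is tested on nonzero vectors; the choice of `rep` is harmless because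
the level sets are invariant under scaling. -/
theorem measurableSet_hasCloseRoots_rep (d : ℕ) (ε : ℝ) :
    MeasurableSet {x : ℙ ℂ (PolyDeg d) | HasCloseRoots ε (toPoly d x.rep)} := by
  have : {x : ℙ ℂ (PolyDeg d) | HasCloseRoots ε (toPoly d x.rep)} =
      ⋃ n, {x | x.rep ∈ rootLevel d ε n} := by
    ext x
    simp [hasCloseRoots_iff_exists_rootLevel, x.rep_nonzero]
  rw [this]
  refine MeasurableSet.iUnion fun n => IsClosed.measurableSet ?_
  rw [← (isQuotientMap_mk' d).isClosed_preimage]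
  convert (isClosed_rootLevel (d := d) ε n).preimage
    (continuous_subtype_val (p := fun v : PolyDeg d => v ≠ 0)) using 1
  ext v
  obtain ⟨t, ht, h⟩ := exists_smul_rep v.1 v.2
  simp [h, rootLevel_smul_iff ht]

theorem continuous_sphereToProj (d : ℕ) : Continuous (sphereToProj d) :=
  (isQuotientMap_mk' d).continuous.comp
    (continuous_subtype_val.subtype_mk fun f => ne_zero_of_mem_unit_sphere f)

end PolyDeg

/-! ### Polar coordinates and cones -/

section Cone

variable {E : Type*} [NormedAddCommGroup E] [NormedSpace ℝ E] [FiniteDimensional ℝ E]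
  [MeasurableSpace E] [BorelSpace E] [Nontrivial E] (μ : Measure E) [μ.IsAddHaarMeasure]

/-- The integral of a radial weight over a cone is proportional to the surface measure of the
trace of the cone on the unit sphere. -/
theorem setLIntegral_norm_of_cone {A : Set E} (hA : MeasurableSet A)
    (hcone : ∀ (r : ℝ) (x : E), 0 < r → (r • x ∈ A ↔ x ∈ A)) {w : ℝ → ℝ≥0∞} (hw : Measurable w) :
    ∫⁻ x in A, w ‖x‖ ∂μ = μ.toSphere (Subtype.val ⁻¹' A) *
      ∫⁻ r : Set.Ioi (0 : ℝ), w r ∂(Measure.volumeIoiPow (Module.finrank ℝ E - 1)) := by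
  have hS : MeasurableSet (Subtype.val ⁻¹' A : Set (sphere (0 : E) 1)) := measurable_subtype_coe hA
  -- The origin is a null set; polar coordinates exist only off it.
  have hpunct : ∫⁻ x, A.indicator (fun x => w ‖x‖) x ∂μ =
      ∫⁻ x in {0}ᶜ, A.indicator (fun x => w ‖x‖) x ∂μ := by
    rw [restrict_compl_singleton]
  rw [← lintegral_indicator hA, hpunct, ← lintegral_subtype_comap (measurableSet_singleton _).compl,
    ← MeasurePreserving.lintegral_comp_emb
      (μ.measurePreserving_homeomorphUnitSphereProd.symm
        (homeomorphUnitSphereProd E).toMeasurableEquiv) (MeasurableEquiv.measurableEmbedding _)]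
  have : ∀ y : sphere (0 : E) 1 × Set.Ioi (0 : ℝ),
      A.indicator (fun x => w ‖x‖)
        (((homeomorphUnitSphereProd E).toMeasurableEquiv.symm y : ({0}ᶜ : Set E)) : E) =
      (Subtype.val ⁻¹' A : Set (sphere (0 : E) 1)).indicator 1 y.1 * w y.2 := by
    rintro ⟨s, r, hr⟩
    have hr' : 0 < r := hr
    change A.indicator (fun x => w ‖x‖) (r • (s : E)) = _
    have hn : ‖r • (s : E)‖ = r := by
      rw [norm_smul, norm_eq_of_mem_sphere, mul_one, Real.norm_of_nonneg hr'.le]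
    by_cases hs : (s : E) ∈ A
    · rw [Set.indicator_of_mem ((hcone r s hr').2 hs), hn, Set.indicator_of_mem (by exact hs)]
      simp
    · rw [Set.indicator_of_notMem (fun h => hs ((hcone r s hr').1 h)), Set.indicator_of_notMem (by exact hs)]
      simp
  simp only [this]
  rw [lintegral_prod_mul (f := (Subtype.val ⁻¹' A : Set (sphere (0 : E) 1)).indicator 1)
    (g := fun r : Set.Ioi (0 : ℝ) => w r) (by fun_prop (disch := assumption)) (by fun_prop),
    lintegral_indicator_one hS]

-- The surface measure is the dimension times the measure of the truncated cone over the set, and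
-- that cone lies in `A ∩ ball 0 1`.
omit [FiniteDimensional ℝ E] [Nontrivial E] [μ.IsAddHaarMeasure] in
theorem toSphere_preimage_le_of_cone {A : Set E} (hA : MeasurableSet A)
    (hcone : ∀ (r : ℝ) (x : E), 0 < r → (r • x ∈ A ↔ x ∈ A)) :
    μ.toSphere (Subtype.val ⁻¹' A) ≤ Module.finrank ℝ E * μ (A ∩ ball 0 1) := by
  rw [μ.toSphere_apply' (measurable_subtype_coe hA)]
  gcongr
  rintro _ ⟨r, hr, _, ⟨s, hs, rfl⟩, rfl⟩
  refine ⟨(hcone r s hr.1).2 hs, ?_⟩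
  rw [mem_ball_zero_iff, norm_smul, norm_eq_of_mem_sphere, mul_one, Real.norm_of_nonneg hr.1.le]
  exact hr.2

theorem lintegral_exp_neg_sq_volumeIoiPow_ne_zero (n : ℕ) :
    ∫⁻ r : Set.Ioi (0 : ℝ), ENNReal.ofReal (Real.exp (-(r : ℝ) ^ 2))
      ∂(Measure.volumeIoiPow n) ≠ 0 := by
  intro h
  rw [lintegral_eq_zero_iff (by fun_prop)] at h
  have h0 : Measure.volumeIoiPow n = 0 := by
    rw [← ae_eq_bot, ← Filter.eventually_false_iff_eq_bot]
    filter_upwards [h] with r hr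
    have : 0 < ENNReal.ofReal (Real.exp (-(r : ℝ) ^ 2)) := ENNReal.ofReal_pos.2 (Real.exp_pos _)
    exact this.ne' hr
  have h1 := Measure.volumeIoiPow_apply_Iio n ⟨1, Set.mem_Ioi.2 one_pos⟩
  rw [h0] at h1
  simp only [Measure.coe_zero, Pi.zero_apply, one_pow] at h1
  exact (ENNReal.ofReal_pos.2 (by positivity : (0 : ℝ) < 1 / (n + 1))).ne h1

theorem integrable_exp_neg_norm_sq : Integrable (fun x : E => Real.exp (-‖x‖ ^ 2)) μ := by
  rw [integrable_fun_norm_addHaar μ (f := fun r : ℝ => Real.exp (-r ^ 2))]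
  have := (integrable_rpow_mul_exp_neg_mul_sq one_pos
    (s := ((Module.finrank ℝ E - 1 : ℕ) : ℝ)) (by
      have : (0 : ℝ) ≤ ((Module.finrank ℝ E - 1 : ℕ) : ℝ) := Nat.cast_nonneg _
      linarith)).integrableOn (s := Set.Ioi 0)
  simpa [Real.rpow_natCast] using this

end Cone

/-! ### Gaussian and uniform probabilities of cones -/

namespace PolyDeg

variable {d : ℕ}

instance (d : ℕ) : Nontrivial (PolyDeg d) :=
  ⟨⟨⟨1, mem_degreeLE.2 (by rw [degree_one]; exact_mod_cast d.zero_le)⟩, 0, fun h =>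
    one_ne_zero (congrArg Subtype.val h : (1 : ℂ[X]) = 0)⟩⟩

instance (d : ℕ) : FiniteDimensional ℝ (PolyDeg d) := FiniteDimensional.trans ℝ ℂ (PolyDeg d)

theorem toSphere_univ_ne_zero (d : ℕ) :
    (Measure.addHaar : Measure (PolyDeg d)).toSphere Set.univ ≠ 0 := by
  rw [ne_eq, Measure.measure_univ_eq_zero]
  exact Measure.toSphere_ne_zero _

instance (d : ℕ) : IsProbabilityMeasure (sphereProb d) :=
  ⟨by simpa [sphereProb] using
    ENNReal.inv_mul_cancel (toSphere_univ_ne_zero d) (measure_ne_top _ _)⟩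

instance (d : ℕ) : IsProbabilityMeasure (uniformProj d) :=
  Measure.isProbabilityMeasure_map (continuous_sphereToProj d).aemeasurable

theorem gaussianUnnorm_of_cone {A : Set (PolyDeg d)} (hA : MeasurableSet A)
    (hcone : ∀ (r : ℝ) (x : PolyDeg d), 0 < r → (r • x ∈ A ↔ x ∈ A)) :
    gaussianUnnorm d A = (Measure.addHaar : Measure (PolyDeg d)).toSphere (Subtype.val ⁻¹' A) *
      ∫⁻ r : Set.Ioi (0 : ℝ), ENNReal.ofReal (Real.exp (-(r : ℝ) ^ 2))
        ∂(Measure.volumeIoiPow (Module.finrank ℝ (PolyDeg d) - 1)) := by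
  rw [gaussianUnnorm, withDensity_apply _ hA]
  exact setLIntegral_norm_of_cone _ hA hcone
    (w := fun r => ENNReal.ofReal (Real.exp (-r ^ 2))) (by fun_prop)

theorem gaussianUnnorm_univ_ne_top (d : ℕ) : gaussianUnnorm d Set.univ ≠ ∞ := by
  rw [gaussianUnnorm, withDensity_apply _ MeasurableSet.univ, Measure.restrict_univ]
  exact ((integrable_exp_neg_norm_sq (Measure.addHaar : Measure (PolyDeg d))).lintegral_lt_top).ne

theorem gaussianUnnorm_univ_ne_zero (d : ℕ) : gaussianUnnorm d Set.univ ≠ 0 := by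
  rw [gaussianUnnorm_of_cone MeasurableSet.univ (by simp)]
  exact mul_ne_zero (toSphere_univ_ne_zero d) (lintegral_exp_neg_sq_volumeIoiPow_ne_zero _)

instance (d : ℕ) : IsProbabilityMeasure (gaussianProb d) :=
  ⟨by simpa [gaussianProb] using
    ENNReal.inv_mul_cancel (gaussianUnnorm_univ_ne_zero d) (gaussianUnnorm_univ_ne_top d)⟩

/-- The normal distribution and the uniform distribution on the sphere agree on cones. -/
theorem gaussianProb_of_cone {A : Set (PolyDeg d)} (hA : MeasurableSet A)
    (hcone : ∀ (r : ℝ) (x : PolyDeg d), 0 < r → (r • x ∈ A ↔ x ∈ A)) :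
    gaussianProb d A = sphereProb d (Subtype.val ⁻¹' A) := by
  have hu := gaussianUnnorm_of_cone (d := d) MeasurableSet.univ (by simp)
  have hfin := gaussianUnnorm_univ_ne_top d
  rw [hu, Set.preimage_univ] at hfin
  have hc0 := lintegral_exp_neg_sq_volumeIoiPow_ne_zero (Module.finrank ℝ (PolyDeg d) - 1)
  have hs0 := toSphere_univ_ne_zero d
  -- The radial integral is neither `0` nor `∞`, so it cancels in the normalization.
  have hct := (ENNReal.lt_top_of_mul_ne_top_right hfin hs0).ne
  simp only [gaussianProb, sphereProb, Measure.smul_apply, smul_eq_mul]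
  rw [gaussianUnnorm_of_cone hA hcone, hu, Set.preimage_univ,
    ENNReal.mul_inv (Or.inl hs0) (Or.inl (measure_ne_top _ _)),
    mul_mul_mul_comm, ENNReal.inv_mul_cancel hc0 hct, mul_one]

theorem sphereProb_le_of_cone {A : Set (PolyDeg d)} (hA : MeasurableSet A)
    (hcone : ∀ (r : ℝ) (x : PolyDeg d), 0 < r → (r • x ∈ A ↔ x ∈ A)) :
    sphereProb d (Subtype.val ⁻¹' A) ≤
      ((Measure.addHaar : Measure (PolyDeg d)) (ball 0 1))⁻¹ *
        (Measure.addHaar : Measure (PolyDeg d)) (A ∩ ball 0 1) := by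
  have hn : (Module.finrank ℝ (PolyDeg d) : ℝ≥0∞) ≠ 0 := by
    exact_mod_cast (Module.finrank_pos (R := ℝ) (M := PolyDeg d)).ne'
  have hn' : (Module.finrank ℝ (PolyDeg d) : ℝ≥0∞) ≠ ∞ := ENNReal.natCast_ne_top _
  simp only [sphereProb, Measure.smul_apply, smul_eq_mul]
  grw [toSphere_preimage_le_of_cone _ hA hcone]
  rw [Measure.toSphere_apply_univ, ENNReal.mul_inv (Or.inl hn) (Or.inl hn'),
    mul_mul_mul_comm, ENNReal.inv_mul_cancel hn hn', one_mul]

end PolyDeg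

/-! ### From two roots to the two lowest coefficients -/

theorem volume_annulus_le {r ε : ℝ} (hr : 0 ≤ r) (hr1 : r ≤ 1) (hε : 0 ≤ ε) (hε1 : ε ≤ 1) :
    volume {z : ℂ | r < ‖z‖ ∧ ‖z‖ ≤ (1 + ε) * r} ≤ ENNReal.ofReal (3 * Real.pi * ε) := by
  have hset : {z : ℂ | r < ‖z‖ ∧ ‖z‖ ≤ (1 + ε) * r} =
      closedBall 0 ((1 + ε) * r) \ closedBall 0 r := by
    ext z
    simp [and_comm]
  have hpi : ((NNReal.pi : ℝ≥0) : ℝ≥0∞) = ENNReal.ofReal Real.pi := by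
    rw [← NNReal.coe_real_pi, ENNReal.ofReal_coe_nnreal]
  rw [hset, measure_sdiff (closedBall_subset_closedBall (by nlinarith))
    measurableSet_closedBall.nullMeasurableSet measure_closedBall_lt_top.ne,
    Complex.volume_closedBall, Complex.volume_closedBall, hpi,
    ← ENNReal.ofReal_pow (by positivity), ← ENNReal.ofReal_pow hr,
    ← ENNReal.ofReal_mul (by positivity), ← ENNReal.ofReal_mul (by positivity),
    ← ENNReal.ofReal_sub _ (by positivity)]
  apply ENNReal.ofReal_le_ofReal
  have h1 : r ^ 2 ≤ 1 := pow_le_one₀ hr hr1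
  have h2 : (2 * ε + ε ^ 2) * r ^ 2 ≤ 3 * ε := by nlinarith [sq_nonneg r]
  nlinarith [Real.pi_pos]

/-- Coefficient vectors of polynomials of degree at most `m + 2`, the two lowest coefficients
split off. -/
abbrev SplitCoeffs (m : ℕ) : Type := ℂ × ℂ × (Fin (m + 1) → ℂ)

namespace SplitCoeffs

variable {m : ℕ}

instance (m : ℕ) : (volume : Measure (SplitCoeffs m)).IsAddHaarMeasure := by
  have : (volume : Measure (ℂ × (Fin (m + 1) → ℂ))).IsAddHaarMeasure :=
    Measure.prod.instIsAddHaarMeasure volume volume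
  exact Measure.prod.instIsAddHaarMeasure volume volume

/-- The coefficient of `X` of the polynomial with roots `x.1` and `x.2.1` and with the
coefficients `x.2.2` in degrees at least two. -/
def coeffOne (x : SplitCoeffs m) : ℂ :=
  -∑ i : Fin (m + 1), x.2.2 i * ∑ j ∈ Finset.range (i + 2), x.1 ^ j * x.2.1 ^ (i + 2 - 1 - j)

/-- The constant coefficient of the polynomial with roots `x.1` and `x.2.1` and with the
coefficients `x.2.2` in degrees at least two. -/
def coeffZero (x : SplitCoeffs m) : ℂ :=
  -(coeffOne x * x.1) - ∑ i : Fin (m + 1), x.2.2 i * x.1 ^ ((i : ℕ) + 2)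

/-- The map that replaces two roots by the two lowest coefficients. -/
def rootsToCoeffs (x : SplitCoeffs m) : SplitCoeffs m := (coeffZero x, coeffOne x, x.2.2)

theorem contDiff_rootsToCoeffs : ContDiff ℝ 1 (rootsToCoeffs (m := m)) := by
  unfold rootsToCoeffs coeffZero coeffOne
  fun_prop

/-- Subtracting the two root equations and dividing by `ζ - ξ` gives `b`, since `ζ^k - ξ^k` is `ζ -
ξ` times a geometric sum; either equation then gives `a`. -/
theorem rootsToCoeffs_eq {ζ ξ a b : ℂ} {c : Fin (m + 1) → ℂ} (hne : ζ ≠ ξ)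
    (hζ : a + b * ζ + ∑ i, c i * ζ ^ ((i : ℕ) + 2) = 0)
    (hξ : a + b * ξ + ∑ i, c i * ξ ^ ((i : ℕ) + 2) = 0) :
    rootsToCoeffs (ζ, ξ, c) = (a, b, c) := by
  have hb : coeffOne (ζ, ξ, c) = b := by
    apply mul_right_cancel₀ (sub_ne_zero.2 hne)
    have hsum : (∑ i : Fin (m + 1), c i * ∑ j ∈ Finset.range ((i : ℕ) + 2),
        ζ ^ j * ξ ^ ((i : ℕ) + 2 - 1 - j)) * (ζ - ξ) =
        ∑ i, c i * ζ ^ ((i : ℕ) + 2) - ∑ i, c i * ξ ^ ((i : ℕ) + 2) := by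
      rw [Finset.sum_mul, ← Finset.sum_sub_distrib]
      refine Finset.sum_congr rfl fun i _ => ?_
      rw [mul_assoc, geom_sum₂_mul, mul_sub]
    rw [coeffOne, neg_mul, hsum]
    linear_combination hξ - hζ
  have ha : coeffZero (ζ, ξ, c) = a := by
    rw [coeffZero, hb]
    linear_combination -hζ
  rw [rootsToCoeffs, ha, hb]

/-- Pairs of roots in the annular region `|ξ| < |ζ| ≤ (1 + ε) |ξ|`, `|ξ| ≤ 1`, together with
coefficients of size at most `R`. -/
def closePairs (m : ℕ) (ε R : ℝ) : Set (SplitCoeffs m) :=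
  {x | ‖x.2.1‖ < ‖x.1‖ ∧ ‖x.1‖ ≤ (1 + ε) * ‖x.2.1‖ ∧ ‖x.2.1‖ ≤ 1 ∧ ‖x.2.2‖ ≤ R}

theorem measurableSet_closePairs (ε R : ℝ) : MeasurableSet (closePairs m ε R) := by
  simp only [closePairs, Set.ofPred_and]
  exact (measurableSet_lt (by fun_prop) (by fun_prop)).inter
    ((measurableSet_le (by fun_prop) (by fun_prop)).inter
    ((measurableSet_le (by fun_prop) (by fun_prop)).inter
    (measurableSet_le (by fun_prop) (by fun_prop))))

/-- Fubini: for fixed `ξ` and coefficients, `ζ` ranges over an annulus. -/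
theorem volume_closePairs_le {ε R : ℝ} (hε : 0 ≤ ε) (hε1 : ε ≤ 1) (hR : 1 ≤ R) :
    volume (closePairs m ε R) ≤ ENNReal.ofReal (3 * Real.pi * ε) *
      volume (closedBall (0 : ℂ × (Fin (m + 1) → ℂ)) R) := by
  rw [Measure.volume_eq_prod, Measure.prod_apply_symm (measurableSet_closePairs ε R),
    ← setLIntegral_const, ← lintegral_indicator measurableSet_closedBall]
  refine lintegral_mono fun y => ?_
  by_cases hy : ‖y.1‖ ≤ 1 ∧ ‖y.2‖ ≤ R
  · rw [Set.indicator_of_mem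
      (mem_closedBall_zero_iff.2 (by rw [Prod.norm_def]; exact max_le (hy.1.trans hR) hy.2))]
    refine (measure_mono ?_).trans (volume_annulus_le (norm_nonneg y.1) hy.1 hε hε1)
    exact fun z hz => ⟨hz.1, hz.2.1⟩
  · have : (fun z => (z, y)) ⁻¹' closePairs m ε R = ∅ := by
      ext z
      simp only [closePairs, Set.mem_preimage, Set.mem_ofPred_eq, Set.mem_empty_iff_false, iff_false]
      exact fun h => hy h.2.2
    simp [this]

/-- The area formula inequality needs no injectivity, so it does not matter that a polynomial may
arise from several pairs. -/
theorem exists_volume_image_closePairs_le (m : ℕ) {R : ℝ} (hR : 1 ≤ R) :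
    ∃ C : ℝ≥0, ∀ ε : ℝ, 0 ≤ ε → ε ≤ 1 →
      volume (rootsToCoeffs '' closePairs m ε R) ≤ C * ENNReal.ofReal ε := by
  have hcont : Continuous fun x : SplitCoeffs m => |(fderiv ℝ rootsToCoeffs x).det| := by
    have h1 : Continuous fun x : SplitCoeffs m => fderiv ℝ rootsToCoeffs x :=
      contDiff_rootsToCoeffs.continuous_fderiv one_ne_zero
    exact (ContinuousLinearMap.continuous_det.comp h1).abs
  -- The radius `2 * R` suffices because `|ζ| ≤ (1 + ε)|ξ| ≤ 2`.
  obtain ⟨D, hD⟩ := (isCompact_closedBall (0 : SplitCoeffs m) (2 * R)).bddAbove_image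
    hcont.continuousOn
  have hV : volume (closedBall (0 : ℂ × (Fin (m + 1) → ℂ)) R) ≠ ∞ := measure_closedBall_lt_top.ne
  refine ⟨D.toNNReal * ((3 * Real.pi).toNNReal *
    (volume (closedBall (0 : ℂ × (Fin (m + 1) → ℂ)) R)).toNNReal), fun ε hε hε1 => ?_⟩
  have hS := measurableSet_closePairs (m := m) ε R
  calc volume (rootsToCoeffs '' closePairs m ε R)
      ≤ ∫⁻ x in closePairs m ε R, ENNReal.ofReal |(fderiv ℝ rootsToCoeffs x).det| :=
        addHaar_image_le_lintegral_abs_det_fderiv _ hS fun x _ =>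
          (contDiff_rootsToCoeffs.differentiable one_ne_zero x).hasFDerivAt.hasFDerivWithinAt
    _ ≤ ∫⁻ x in closePairs m ε R, ENNReal.ofReal D := by
        refine setLIntegral_mono measurable_const fun x hx => ENNReal.ofReal_le_ofReal ?_
        refine hD ⟨x, mem_closedBall_zero_iff.2 ?_, rfl⟩
        obtain ⟨-, h2, h3, h4⟩ := hx
        rw [Prod.norm_def, Prod.norm_def]
        refine max_le ?_ (max_le ?_ ?_) <;> nlinarith [norm_nonneg x.2.1]
    _ ≤ ENNReal.ofReal D * (ENNReal.ofReal (3 * Real.pi * ε) *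
          volume (closedBall (0 : ℂ × (Fin (m + 1) → ℂ)) R)) := by
        rw [setLIntegral_const]
        gcongr
        exact volume_closePairs_le hε hε1 hR
    _ = _ := by
        rw [ENNReal.ofReal_mul (by positivity)]
        push_cast
        rw [ENNReal.coe_toNNReal hV, ENNReal.ofReal, ENNReal.ofReal]
        ring

end SplitCoeffs

/-! ### Transfer to the space of polynomials -/

namespace PolyDeg

/-- The coefficients of a polynomial, the two lowest ones split off. -/
def splitCoeffs (m : ℕ) : PolyDeg (m + 2) →ₗ[ℂ] SplitCoeffs m where
  toFun f := ((toPoly _ f).coeff 0, (toPoly _ f).coeff 1, fun i => (toPoly _ f).coeff (i + 2))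
  map_add' f g := by
    ext <;> simp
  map_smul' c f := by
    ext <;> simp

theorem splitCoeffs_bijective (m : ℕ) : Function.Bijective (splitCoeffs m) := by
  constructor
  · intro f g h
    apply toPoly_injective
    simp only [splitCoeffs, LinearMap.coe_mk, AddHom.coe_mk, Prod.mk.injEq, funext_iff] at h
    ext n
    match n with
    | 0 => exact h.1
    | 1 => exact h.2.1
    | n + 2 =>
      rcases Nat.lt_or_ge n (m + 1) with hn | hn
      · exact h.2.2 ⟨n, hn⟩
      · rw [coeff_eq_zero_of_natDegree_lt ((natDegree_toPoly_le f).trans_lt (by omega)),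
          coeff_eq_zero_of_natDegree_lt ((natDegree_toPoly_le g).trans_lt (by omega))]
  · rintro ⟨a, b, c⟩
    refine ⟨⟨C a + C b * X + ∑ i : Fin (m + 1), C (c i) * X ^ ((i : ℕ) + 2), ?_⟩, ?_⟩
    · refine Submodule.add_mem _ (Submodule.add_mem _ ?_ ?_) (Submodule.sum_mem _ fun i _ => ?_)
      · exact mem_degreeLE.2 (degree_C_le.trans (by exact_mod_cast Nat.zero_le _))
      · exact mem_degreeLE.2 ((degree_C_mul_X_le b).trans (by exact_mod_cast (by omega : 1 ≤ m + 2)))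
      · exact mem_degreeLE.2 ((degree_C_mul_X_pow_le _ _).trans
          (by exact_mod_cast (by omega : (i : ℕ) + 2 ≤ m + 2)))
    · refine Prod.ext ?_ (Prod.ext ?_ (funext fun i => ?_))
      · change (C a + C b * X + ∑ i : Fin (m + 1), C (c i) * X ^ ((i : ℕ) + 2)).coeff 0 = a
        simp [finsetSum_coeff]
      · change (C a + C b * X + ∑ i : Fin (m + 1), C (c i) * X ^ ((i : ℕ) + 2)).coeff 1 = b
        simp [finsetSum_coeff, coeff_C, coeff_X_pow]
      · change (C a + C b * X + ∑ i : Fin (m + 1), C (c i) * X ^ ((i : ℕ) + 2)).coeff (i + 2) = c i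
        simp [finsetSum_coeff, coeff_X_pow, Fin.val_inj]

/-- `splitCoeffs` as a continuous real-linear equivalence. -/
def splitCoeffsEquiv (m : ℕ) : PolyDeg (m + 2) ≃L[ℝ] SplitCoeffs m :=
  ((LinearEquiv.ofBijective (splitCoeffs m) (splitCoeffs_bijective m)).restrictScalars
    ℝ).toContinuousLinearEquiv

/-- Uniqueness of Haar measure up to scaling. No measurability of `B` is needed, as the coordinates
form a homeomorphism. -/
theorem exists_addHaar_eq_volume_splitCoeffs (m : ℕ) :
    ∃ c : ℝ≥0, ∀ B : Set (PolyDeg (m + 2)),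
      (Measure.addHaar : Measure (PolyDeg (m + 2))) B = c * volume (splitCoeffs m '' B) := by
  let e := splitCoeffsEquiv m
  let ν : Measure (SplitCoeffs m) := (Measure.addHaar : Measure (PolyDeg (m + 2))).map e
  have : ν.IsAddHaarMeasure := e.isAddHaarMeasure_map _
  refine ⟨ν.addHaarScalarFactor volume, fun B => ?_⟩
  have h1 : ν (e '' B) = (Measure.addHaar : Measure (PolyDeg (m + 2))) B := by
    change ((Measure.addHaar : Measure (PolyDeg (m + 2))).map
      e.toHomeomorph.toMeasurableEquiv) (e '' B) = _
    rw [MeasurableEquiv.map_apply]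
    congr 1
    exact Set.preimage_image_eq _ e.injective
  rw [← h1]
  exact DFunLike.congr_fun (Measure.isAddLeftInvariant_eq_smul ν volume) (e '' B)

/-- The polynomials with coefficients of size at most `R` and with roots `ζ`, `ξ` such that
`|ξ| < |ζ| ≤ (1 + ε) |ξ|` and `|ξ| ≤ 1`. -/
def closeRootsInDisc (d : ℕ) (ε R : ℝ) : Set (PolyDeg d) :=
  {f | (∀ i, ‖(toPoly d f).coeff i‖ ≤ R) ∧ ∃ ζ ξ : ℂ, (toPoly d f).IsRoot ζ ∧
    (toPoly d f).IsRoot ξ ∧ ‖ξ‖ < ‖ζ‖ ∧ ‖ζ‖ ≤ (1 + ε) * ‖ξ‖ ∧ ‖ξ‖ ≤ 1}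

theorem splitCoeffs_image_subset (m : ℕ) {ε R : ℝ} (hR : 0 ≤ R) :
    splitCoeffs m '' closeRootsInDisc (m + 2) ε R ⊆
      SplitCoeffs.rootsToCoeffs '' SplitCoeffs.closePairs m ε R := by
  rintro _ ⟨f, ⟨hf, ζ, ξ, hζ, hξ, h1, h2, h3⟩, rfl⟩
  have hne : ζ ≠ ξ := by
    rintro rfl
    exact lt_irrefl _ h1
  have heval : ∀ z, (toPoly _ f).IsRoot z → (toPoly _ f).coeff 0 + (toPoly _ f).coeff 1 * z +
      ∑ i : Fin (m + 1), (toPoly _ f).coeff ((i : ℕ) + 2) * z ^ ((i : ℕ) + 2) = 0 := by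
    intro z hz
    rw [← hz.eq_zero, eval_toPoly, Finset.sum_range_succ', Finset.sum_range_succ',
      Finset.sum_range fun i => (toPoly _ f).coeff (i + 1 + 1) * z ^ (i + 1 + 1)]
    ring
  refine ⟨(ζ, ξ, fun i => (toPoly _ f).coeff (i + 2)), ⟨h1, h2, h3, ?_⟩, ?_⟩
  · exact (pi_norm_le_iff_of_nonneg hR).2 fun i => hf _
  · exact SplitCoeffs.rootsToCoeffs_eq hne (heval ζ hζ) (heval ξ hξ)

theorem exists_addHaar_closeRootsInDisc_le (m : ℕ) {R : ℝ} (hR : 1 ≤ R) :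
    ∃ C : ℝ≥0, ∀ ε : ℝ, 0 ≤ ε → ε ≤ 1 →
      (Measure.addHaar : Measure (PolyDeg (m + 2))) (closeRootsInDisc (m + 2) ε R) ≤
        C * ENNReal.ofReal ε := by
  obtain ⟨C, hC⟩ := SplitCoeffs.exists_volume_image_closePairs_le m hR
  obtain ⟨c, hc⟩ := exists_addHaar_eq_volume_splitCoeffs m
  refine ⟨c * C, fun ε hε hε1 => ?_⟩
  rw [hc, ENNReal.coe_mul, mul_assoc]
  gcongr
  exact (measure_mono (splitCoeffs_image_subset m (by linarith))).trans (hC ε hε hε1)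

/-! ### Inversion of the roots and the volume bound -/

variable {d : ℕ}

/-- The polynomial with the coefficients in reversed order. -/
def reversal (d : ℕ) : PolyDeg d →ₗ[ℂ] PolyDeg d where
  toFun f := ⟨(toPoly d f).reflect d, mem_degreeLE.2 (natDegree_le_iff_degree_le.1
    (natDegree_reflect_le.trans (max_le le_rfl (natDegree_toPoly_le f))))⟩
  map_add' f g := by
    apply toPoly_injective
    change reflect d (toPoly d (f + g)) = reflect d (toPoly d f) + reflect d (toPoly d g)
    rw [map_add, reflect_add]
  map_smul' c f := by
    apply toPoly_injective
    change reflect d (toPoly d (c • f)) = c • reflect d (toPoly d f)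
    rw [map_smul, smul_eq_C_mul, reflect_C_mul, smul_eq_C_mul]

theorem toPoly_reversal (f : PolyDeg d) : toPoly d (reversal d f) = (toPoly d f).reflect d := rfl

theorem reversal_involutive (d : ℕ) : Function.Involutive (reversal d) := by
  intro f
  apply toPoly_injective
  rw [toPoly_reversal, toPoly_reversal, reflect_reflect]

theorem isRoot_reversal_inv {f : PolyDeg d} {z : ℂ} (hz : z ≠ 0) (h : (toPoly d f).IsRoot z) :
    (toPoly d (reversal d f)).IsRoot z⁻¹ := by
  have := invertibleOfNonzero hz
  have h' := (eval₂_reflect_eq_zero_iff (RingHom.id ℂ) z d _ (natDegree_toPoly_le f)).2 h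
  rwa [invOf_eq_inv] at h'

theorem norm_coeff_le (f : PolyDeg d) (i : ℕ) : ‖(toPoly d f).coeff i‖ ≤ 2 ^ d * ‖f‖ := by
  rcases Nat.lt_or_ge d i with hi | hi
  · rw [coeff_eq_zero_of_natDegree_lt ((natDegree_toPoly_le f).trans_lt hi), norm_zero]
    positivity
  · have h1 : ‖(toPoly d f).coeff i‖ ^ 2 / d.choose i ≤ ‖f‖ ^ 2 := by
      rw [norm_eq, Real.sq_sqrt (Finset.sum_nonneg fun i _ => by positivity)]
      exact Finset.single_le_sum
        (f := fun i => ‖(toPoly d f).coeff i‖ ^ 2 / (d.choose i : ℝ))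
        (fun i _ => by positivity) (Finset.mem_range.2 (Nat.lt_succ_of_le hi))
    rw [div_le_iff₀ (by exact_mod_cast Nat.choose_pos hi)] at h1
    have h2 : (d.choose i : ℝ) ≤ 2 ^ d := by exact_mod_cast Nat.choose_le_two_pow d i
    have h3 : (1 : ℝ) ≤ 2 ^ d := one_le_pow₀ (by norm_num)
    -- The binomial coefficient is bounded by `4 ^ d` to avoid a square root.
    refine abs_le_of_sq_le_sq' ?_ (by positivity) |>.2
    calc ‖(toPoly d f).coeff i‖ ^ 2 ≤ ‖f‖ ^ 2 * d.choose i := h1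
      _ ≤ ‖f‖ ^ 2 * (2 ^ d * 2 ^ d) := by
        gcongr
        nlinarith
      _ = (2 ^ d * ‖f‖) ^ 2 := by ring

/-- If `|ξ| > 1`, then `ξ⁻¹` and `ζ⁻¹` lie in the unit disc, with roles exchanged and the same ratio
of moduli. -/
theorem hasCloseRoots_inter_ball_subset (ε : ℝ) :
    {f : PolyDeg d | HasCloseRoots ε (toPoly d f)} ∩ ball 0 1 ⊆
      closeRootsInDisc d ε (2 ^ d) ∪ reversal d ⁻¹' closeRootsInDisc d ε (2 ^ d) := by
  rintro f ⟨⟨-, ζ, ξ, hζ, hξ, h1, h2⟩, hf⟩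
  have hcoeff : ∀ i, ‖(toPoly d f).coeff i‖ ≤ 2 ^ d := fun i =>
    (norm_coeff_le f i).trans (mul_le_of_le_one_right (by positivity) (mem_ball_zero_iff.1 hf).le)
  rcases le_or_gt ‖ξ‖ 1 with hle | hgt
  · exact Or.inl ⟨hcoeff, ζ, ξ, hζ, hξ, h1, h2, hle⟩
  · have hξ0 : 0 < ‖ξ‖ := one_pos.trans hgt
    have hζ0 : 0 < ‖ζ‖ := hξ0.trans h1
    refine Or.inr ⟨fun i => ?_, ξ⁻¹, ζ⁻¹, isRoot_reversal_inv (norm_pos_iff.1 hξ0) hξ,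
      isRoot_reversal_inv (norm_pos_iff.1 hζ0) hζ, ?_, ?_, ?_⟩
    · rw [toPoly_reversal, coeff_reflect]
      exact hcoeff _
    · rw [norm_inv, norm_inv]
      exact inv_strictAnti₀ hξ0 h1
    · rw [norm_inv, norm_inv, ← div_eq_mul_inv, le_div_iff₀ hζ0, inv_mul_le_iff₀ hξ0, mul_comm]
      exact h2
    · rw [norm_inv]
      exact inv_le_one_of_one_le₀ (hgt.trans h1).le

theorem exists_addHaar_hasCloseRoots_le (d : ℕ) :
    ∃ C : ℝ≥0, ∀ ε : ℝ, 0 ≤ ε → ε ≤ 1 →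
      (Measure.addHaar : Measure (PolyDeg d))
        ({f | HasCloseRoots ε (toPoly d f)} ∩ ball 0 1) ≤ C * ENNReal.ofReal ε := by
  rcases Nat.lt_or_ge d 2 with hd | hd
  · refine ⟨0, fun ε _ _ => ?_⟩
    have : {f : PolyDeg d | HasCloseRoots ε (toPoly d f)} = ∅ :=
      Set.eq_empty_of_forall_notMem fun f hf =>
        (hf.two_le_natDegree.trans (natDegree_toPoly_le f)).not_gt hd
    simp [this]
  · obtain ⟨m, rfl⟩ := Nat.exists_eq_add_of_le' hd
    obtain ⟨C, hC⟩ := exists_addHaar_closeRootsInDisc_le m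
      (R := 2 ^ (m + 2)) (one_le_pow₀ (by norm_num))
    let e : PolyDeg (m + 2) ≃L[ℝ] PolyDeg (m + 2) :=
      ((LinearEquiv.ofInvolutive (reversal (m + 2))
        (reversal_involutive _)).restrictScalars ℝ).toContinuousLinearEquiv
    -- The second term is the change of volume under reversal; only its finiteness matters.
    refine ⟨C + |LinearMap.det (e.symm : PolyDeg (m + 2) →ₗ[ℝ] PolyDeg (m + 2))|.toNNReal * C,
      fun ε hε hε1 => ?_⟩
    refine (measure_mono (hasCloseRoots_inter_ball_subset ε)).trans
      ((measure_union_le _ _).trans ?_)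
    rw [ENNReal.coe_add, ENNReal.coe_mul, add_mul, mul_assoc]
    refine add_le_add (hC ε hε hε1) ?_
    refine (Measure.addHaar_preimage_continuousLinearEquiv _ e
      (closeRootsInDisc (m + 2) ε (2 ^ (m + 2)))).le.trans ?_
    exact mul_le_mul_right (hC ε hε hε1) _

theorem hasCloseRoots_cone (ε : ℝ) (r : ℝ) (f : PolyDeg d) (hr : 0 < r) :
    r • f ∈ {f : PolyDeg d | HasCloseRoots ε (toPoly d f)} ↔
      f ∈ {f : PolyDeg d | HasCloseRoots ε (toPoly d f)} := by
  change HasCloseRoots ε (toPoly d ((r : ℂ) • f)) ↔ HasCloseRoots ε (toPoly d f)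
  rw [map_smul, hasCloseRoots_smul_iff (by exact_mod_cast hr.ne')]

theorem exists_sphereProb_hasCloseRoots_le (d : ℕ) :
    ∃ C : ℝ, 0 < C ∧ ∀ ε : ℝ, 0 < ε →
      (sphereProb d).real (Subtype.val ⁻¹' {f | HasCloseRoots ε (toPoly d f)}) ≤ C * ε := by
  obtain ⟨C, hC⟩ := exists_addHaar_hasCloseRoots_le d
  have hb : ((Measure.addHaar : Measure (PolyDeg d)) (ball 0 1))⁻¹ ≠ ∞ :=
    ENNReal.inv_ne_top.2 (measure_ball_pos _ _ one_pos).ne'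
  set b := (((Measure.addHaar : Measure (PolyDeg d)) (ball 0 1))⁻¹).toNNReal with hbdef
  -- The summand `1` makes the constant positive and settles `ε > 1`, where any probability is at
  -- most `ε`.
  refine ⟨(b * C : ℝ≥0) + 1, by positivity, fun ε hε => ?_⟩
  rcases le_or_gt ε 1 with hε1 | hε1
  · have h := (sphereProb_le_of_cone (measurableSet_hasCloseRoots d ε)
      (hasCloseRoots_cone ε)).trans (mul_le_mul_right (hC ε hε.le hε1) _)
    rw [← ENNReal.coe_toNNReal hb, ← hbdef, ← mul_assoc, ← ENNReal.coe_mul] at h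
    have h' := ENNReal.toReal_mono (by finiteness) h
    rw [ENNReal.toReal_mul, ENNReal.coe_toReal, ENNReal.toReal_ofReal hε.le] at h'
    exact h'.trans (by nlinarith)
  · refine measureReal_le_one.trans ?_
    nlinarith [(b * C : ℝ≥0).coe_nonneg]

end PolyDeg

/-! ### The three probability bounds -/

namespace PolyDeg

variable {d : ℕ}

theorem lt_minRootRatio_set {ε : ℝ} (hε : 0 < ε) :
    {f : PolyDeg d | ENNReal.ofReal (1 + ε) < minRootRatio (toPoly d f)} =
      {f | HasCloseRoots ε (toPoly d f)}ᶜ :=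
  Set.ext fun _ => lt_minRootRatio_iff hε.le _

theorem lt_minRootRatioProj_set {ε : ℝ} (hε : 0 < ε) :
    {x : ℙ ℂ (PolyDeg d) | ENNReal.ofReal (1 + ε) < minRootRatioProj d x} =
      {x | HasCloseRoots ε (toPoly d x.rep)}ᶜ := by
  ext x
  rw [Set.mem_ofPred_eq, minRootRatioProj_eq]
  exact lt_minRootRatio_iff hε.le _

theorem uniformProj_hasCloseRoots (ε : ℝ) :
    uniformProj d {x | HasCloseRoots ε (toPoly d x.rep)} =
      sphereProb d (Subtype.val ⁻¹' {f | HasCloseRoots ε (toPoly d f)}) := by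
  rw [uniformProj, Measure.map_apply (continuous_sphereToProj d).measurable
    (measurableSet_hasCloseRoots_rep d ε)]
  congr 1
  ext f
  obtain ⟨t, ht, h⟩ := exists_smul_rep f.1 (ne_zero_of_mem_unit_sphere f)
  simp only [Set.mem_preimage, Set.mem_ofPred_eq, sphereToProj]
  rw [h, map_smul, hasCloseRoots_smul_iff ht]

end PolyDeg

theorem MeasureTheory.Measure.le_mul_of_rnDeriv_le {α : Type*} {mα : MeasurableSpace α}
    {μ ν : Measure α} [ν.HaveLebesgueDecomposition μ] (hνμ : ν ≪ μ) {K : ℝ≥0∞}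
    (hK : ∀ᵐ x ∂μ, ν.rnDeriv μ x ≤ K) {A : Set α} (hA : MeasurableSet A) : ν A ≤ K * μ A := by
  calc ν A = ∫⁻ x in A, ν.rnDeriv μ x ∂μ := by
        rw [← withDensity_apply _ hA, Measure.withDensity_rnDeriv_eq _ _ hνμ]
    _ ≤ ∫⁻ _ in A, K ∂μ := lintegral_mono_ae (ae_restrict_of_ae hK)
    _ = K * μ A := setLIntegral_const _ _

open PolyDeg in
theorem lemma6 (d : ℕ) :
    ∃ M : ℝ, 0 < M ∧ ∀ ε : ℝ, 0 < ε →
      MeasurableSet {x : ℙ ℂ (PolyDeg d) | ENNReal.ofReal (1 + ε) < minRootRatioProj d x} ∧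
      MeasurableSet
        {f : PolyDeg d | ENNReal.ofReal (1 + ε) < minRootRatio (PolyDeg.toPoly d f)} ∧
      -- `f` uniformly distributed on the projective space
      1 - M * ε < (PolyDeg.uniformProj d).real
        {x | ENNReal.ofReal (1 + ε) < minRootRatioProj d x} ∧
      -- `f` normally distributed on the vector space
      1 - M * ε < (PolyDeg.gaussianProb d).real
        {f | ENNReal.ofReal (1 + ε) < minRootRatio (PolyDeg.toPoly d f)} ∧
      -- any other law on the projective space, with Radon–Nikodym derivative at most `K`
      ∀ (ν : Measure (ℙ ℂ (PolyDeg d))) (K : ℝ≥0), IsProbabilityMeasure ν →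
        ν ≪ PolyDeg.uniformProj d →
        (∀ᵐ x ∂(PolyDeg.uniformProj d), ν.rnDeriv (PolyDeg.uniformProj d) x ≤ K) →
        1 - K * M * ε < ν.real {x | ENNReal.ofReal (1 + ε) < minRootRatioProj d x} := by
  obtain ⟨C, hC, hbound⟩ := exists_sphereProb_hasCloseRoots_le d
  -- Enlarging `C` makes the inequalities strict.
  refine ⟨C + 1, by positivity, fun ε hε => ?_⟩
  have hvec := measurableSet_hasCloseRoots d ε
  have hproj := measurableSet_hasCloseRoots_rep d ε
  have hu : (uniformProj d).real {x | HasCloseRoots ε (toPoly d x.rep)} ≤ C * ε := by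
    rw [measureReal_def, uniformProj_hasCloseRoots]
    exact hbound ε hε
  have hg : (gaussianProb d).real {f | HasCloseRoots ε (toPoly d f)} ≤ C * ε := by
    rw [measureReal_def, gaussianProb_of_cone hvec (hasCloseRoots_cone ε)]
    exact hbound ε hε
  rw [lt_minRootRatio_set hε, lt_minRootRatioProj_set hε]
  refine ⟨hproj.compl, hvec.compl, ?_, ?_, fun ν K hν hac hK => ?_⟩
  · rw [probReal_compl_eq_one_sub hproj]
    linarith
  · rw [probReal_compl_eq_one_sub hvec]
    linarith
  · rw [probReal_compl_eq_one_sub hproj]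
    have hle : ν.real {x | HasCloseRoots ε (toPoly d x.rep)} ≤
        K * (uniformProj d).real {x | HasCloseRoots ε (toPoly d x.rep)} := by
      have h := ENNReal.toReal_mono (by finiteness)
        (Measure.le_mul_of_rnDeriv_le hac hK hproj)
      rwa [ENNReal.toReal_mul, ENNReal.coe_toReal] at h
    -- Both laws have total mass one, so `K ≥ 1`; hence `K * C * ε < K * (C + 1) * ε` is strict.
    have hK1 : (1 : ℝ) ≤ K := by
      have h := Measure.le_mul_of_rnDeriv_le hac hK MeasurableSet.univ
      rw [measure_univ, measure_univ, mul_one] at h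
      exact_mod_cast h
    have hKu := mul_le_mul_of_nonneg_left hu K.coe_nonneg
    nlinarith [mul_pos (one_pos.trans_le hK1) hε]

end
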